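/- For $A\subseteq\mathbb Z$ write $A-A=\{a-a' : a,a'\in A\}$, and let $\bar d(A)=\limsup_{n\to\infty}\frac{|A\cap\{1,\dots,n\}|}{n}$ be the upper asymptotic density of $A$. A set $S\subseteq\mathbb Z$ is called density recurrent if $(A-A)\cap S\neq\varnothing$ for every $A\subseteq\mathbb Z$ with $\bar d(A)>0$. It is called chromatically recurrent if for every partition $\{A_1,\dots,A_r\}$ of $\mathbb Z$ into finitely many sets there is a cell $A_j$ with $(A_j-A_j)\cap S\neq\varnothing$. Theorem (Kriz). There is a set of integers which is chromatically recurrent and not density recurrent. -/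

import Mathlib

open Filter
open scoped Pointwise

/-- The upper asymptotic density `limsup_{n → ∞} |A ∩ {1, …, n}| / n` of a set of integers.
The quotients lie in `[0, 1]`, so the real-valued limsup is the true one. -/
noncomputable def upperDensity (A : Set ℤ) : ℝ :=
  limsup (fun n : ℕ => ((A ∩ Set.Icc (1 : ℤ) (n : ℤ)).ncard : ℝ) / (n : ℝ)) atTop

/-- `S` is density recurrent: `A - A` meets `S` whenever `A` has positive upper density. -/
def IsDensityRecurrent (S : Set ℤ) : Prop :=
  ∀ A : Set ℤ, 0 < upperDensity A → ((A - A) ∩ S).Nonempty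

/-- `S` is chromatically recurrent: for every partition of `ℤ` into finitely many sets, the
difference set of some cell meets `S`. -/
def IsChromaticallyRecurrent (S : Set ℤ) : Prop :=
  ∀ P : Set (Set ℤ), P.Finite → Setoid.IsPartition P → ∃ A ∈ P, ((A - A) ∩ S).Nonempty

/-! For each number r of colours there is a finite set that is recurrent for r colours although its
Cayley graph is bipartite off a set of small density. In base M = 2K, take the sums of ±M^i over i <
2N with at most 2r positions missing. Recurrence comes from the Lovász–Kneser theorem: give a set of
positions the colour of the sum of its powers; two large disjoint sets of equal colour have sums
that differ by such a combination (`isChromaticFor_signedSums`). On the other hand, when nothing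
carries, adding such a combination flips the parity of all but at most 2r digits, so it exchanges
integers with many odd digits and integers with few. The exceptions have an extreme digit, which is
rare for large K, or about N odd digits, which is rare for large N (`isNearlyBipartite_signedSums`).

These sets are glued by dilation: the classes of x for one set and of x / M for the other combine to
classes for the union of the first set and the M-fold dilate of the second
(`IsNearlyBipartite.exists_union_image_mul`). With summable errors, one such set for every r can be
added, and the union of all of them is chromatically recurrent. After each addition, one of the two
classes provides a window: a quarter of a long interval, without differences in the current set.
Windows are far apart compared with the current set, and elements added later exceed all differences
within earlier windows. Hence the union of the windows has positive upper density and no difference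
in the final set.

The Lovász–Kneser theorem follows from a lemma of Tucker–Fan type (`exists_alternating_chain`),
proved by a Stokes formula modulo two on explicit hemispheres. -/

/-! ### Cochains modulo two on ordered simplices -/

namespace Cochain

variable {V : Type*}

/-- The simplicial coboundary, modulo two, of a cochain on words of vertices. -/
def coboundary : (List V → ZMod 2) → List V → ZMod 2
  | _, [] => 0
  | φ, v :: w => φ w + coboundary (fun u => φ (v :: u)) w

/-- The dual of the prism operator of a map `f`, which joins a simplex to its image. -/
def prism (f : V → V) : (List V → ZMod 2) → List V → ZMod 2
  | _, [] => 0
  | φ, v :: w => φ (v :: f v :: w.map f) + prism f (fun u => φ (v :: u)) w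

theorem coboundary_add (φ ψ : List V → ZMod 2) (w : List V) :
    coboundary (fun u => φ u + ψ u) w = coboundary φ w + coboundary ψ w := by
  induction w generalizing φ ψ with
  | nil => simp [coboundary]
  | cons v w ih => simp only [coboundary, ih]; ring

theorem coboundary_map (f : V → V) (φ : List V → ZMod 2) (w : List V) :
    coboundary (fun u => φ (u.map f)) w = coboundary φ (w.map f) := by
  induction w generalizing φ with
  | nil => simp [coboundary]
  | cons v w ih =>
    simp only [coboundary, List.map_cons]
    rw [ih (fun u => φ (f v :: u))]

theorem prism_add (f : V → V) (φ ψ : List V → ZMod 2) (w : List V) :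
    prism f (fun u => φ u + ψ u) w = prism f φ w + prism f ψ w := by
  induction w generalizing φ ψ with
  | nil => simp [prism]
  | cons v w ih => simp only [prism, ih]; ring

/-- The boundary of a prism consists of its two ends and the prism over the boundary of its base;
modulo two no signs occur. -/
theorem prism_homotopy (f : V → V) (φ : List V → ZMod 2) (w : List V) :
    prism f (coboundary φ) w = φ w + φ (w.map f) + coboundary (prism f φ) w := by
  induction w generalizing φ with
  | nil => simp [prism, coboundary, CharTwo.add_self_eq_zero]
  | cons v w ih =>
    have h2 : (2 : ZMod 2) = 0 := rfl
    simp only [prism, coboundary, List.map_cons, prism_add, coboundary_add, ih]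
    rw [coboundary_map f (fun u => φ (v :: f v :: u))]
    linear_combination (coboundary (fun u => φ (v :: f v :: u)) (w.map f) + φ (v :: w.map f)
      - coboundary (fun u => φ (v :: f v :: u)) (w.map f)) * h2

/-- The cochain that detects the words on which the sign `s` alternates, beginning with `b`. -/
def alternating (s : V → Bool) : Bool → List V → ZMod 2
  | _, [] => 1
  | b, v :: w => if s v = b then alternating s (!b) w else 0

theorem coboundary_zero (w : List V) : coboundary (fun _ => 0) w = 0 := by
  induction w with
  | nil => rfl
  | cons v w ih => simp [coboundary, ih]

/-- An alternating word stays alternating only after deletion of an end letter, and exactly one of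
the two ends leaves a word beginning with `b` (a single letter leaves the empty word). In a word
that does not alternate, the deletions that repair it come in pairs, one for each letter of the
repeated pair, and cancel. -/
theorem coboundary_alternating (s : V → Bool) (b : Bool) (w : List V) :
    coboundary (alternating s b) w = alternating s b w + alternating s (!b) w := by
  induction w generalizing b with
  | nil => simp [coboundary, alternating, CharTwo.add_self_eq_zero]
  | cons v w ih =>
    have h2 : (2 : ZMod 2) = 0 := rfl
    by_cases h : s v = b
    · have h' : s v ≠ !b := by rw [h]; cases b <;> simp
      simp only [coboundary, alternating, h, if_true]
      rw [ih (!b)]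
      have : b ≠ !b := by cases b <;> simp
      simp only [Bool.not_not, if_neg this]
      linear_combination alternating s b w * h2
    · have h' : s v = !b := by
        revert h; cases s v <;> cases b <;> simp
      simp only [coboundary, alternating, h', if_true, Bool.not_not]
      simp [coboundary_zero]

end Cochain

/-! ### Hemispheres of the order complex of signed sets -/

/-- A pair of disjoint finite sets, not both empty, is a vertex of the barycentric subdivision of
the boundary of a cross-polytope; this predicate says that its coordinates are at most `k`. -/
def IsSignedSet (k : ℕ) (v : Finset ℕ × Finset ℕ) : Prop :=
  Disjoint v.1 v.2 ∧ v.1 ∪ v.2 ⊆ Finset.range (k + 1) ∧ (v.1 ∪ v.2).Nonempty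

theorem IsSignedSet.swap {k : ℕ} {v : Finset ℕ × Finset ℕ} (h : IsSignedSet k v) :
    IsSignedSet k v.swap := by
  obtain ⟨h1, h2, h3⟩ := h
  exact ⟨h1.symm, by simpa only [Prod.fst_swap, Prod.snd_swap, Finset.union_comm] using h2,
    by simpa only [Prod.fst_swap, Prod.snd_swap, Finset.union_comm] using h3⟩

theorem IsSignedSet.mono {k l : ℕ} (hkl : k ≤ l) {v : Finset ℕ × Finset ℕ}
    (h : IsSignedSet k v) : IsSignedSet l v :=
  ⟨h.1, h.2.1.trans (Finset.range_mono (by omega)), h.2.2⟩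

/-- Add the coordinate `k` to a signed set, with positive sign. -/
def addPos (k : ℕ) (v : Finset ℕ × Finset ℕ) : Finset ℕ × Finset ℕ := (insert k v.1, v.2)

theorem le_addPos (k : ℕ) (v : Finset ℕ × Finset ℕ) : v ≤ addPos k v :=
  ⟨Finset.subset_insert _ _, le_rfl⟩

theorem addPos_mono (k : ℕ) {u v : Finset ℕ × Finset ℕ} (h : u ≤ v) : addPos k u ≤ addPos k v :=
  ⟨Finset.insert_subset_insert _ h.1, h.2⟩

theorem IsSignedSet.addPos {k : ℕ} {v : Finset ℕ × Finset ℕ} (h : IsSignedSet k v) :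
    IsSignedSet (k + 1) (addPos (k + 1) v) := by
  obtain ⟨h1, h2, h3⟩ := h
  refine ⟨?_, ?_, ?_⟩
  · simp only [_root_.addPos, Finset.disjoint_insert_left]
    refine ⟨fun hk => ?_, h1⟩
    have := h2 (Finset.mem_union_right _ hk)
    simp at this
  · intro x hx
    simp only [_root_.addPos, Finset.insert_union, Finset.mem_insert] at hx
    rcases hx with rfl | hx
    · simp
    · have := h2 hx
      simp only [Finset.mem_range] at this ⊢; omega
  · exact ⟨k + 1, by simp [_root_.addPos]⟩

/-- A word of length `k + 1` that is a weakly increasing chain of signed sets. -/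
def IsSignedChain (k : ℕ) (w : List (Finset ℕ × Finset ℕ)) : Prop :=
  w.length = k + 1 ∧ w.Pairwise (· ≤ ·) ∧ ∀ v ∈ w, IsSignedSet k v

/-- Evaluation of a cochain on the `k`-dimensional upper hemisphere. -/
def hemisphere : ℕ → (List (Finset ℕ × Finset ℕ) → ZMod 2) → ZMod 2
  | 0, φ => φ [({0}, ∅)]
  | k + 1, φ =>
    -- The upper hemisphere is a collar, the prism from the equatorial sphere to its image under
    -- `addPos (k + 1)`, capped by the cone over that image with apex `({k + 1}, ∅)`.
    let ψ : List (Finset ℕ × Finset ℕ) → ZMod 2 := fun w =>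
      Cochain.prism (addPos (k + 1)) φ w + φ (({k + 1}, ∅) :: w.map (addPos (k + 1)))
    hemisphere k ψ + hemisphere k (fun w => ψ (w.map Prod.swap))

theorem hemisphere_add (k : ℕ) (φ ψ : List (Finset ℕ × Finset ℕ) → ZMod 2) :
    hemisphere k (fun w => φ w + ψ w) = hemisphere k φ + hemisphere k ψ := by
  induction k generalizing φ ψ with
  | zero => rfl
  | succ k ih =>
    simp only [hemisphere, Cochain.prism_add, ih]
    ring

/-- Evaluation of a cochain on the `k`-dimensional sphere. -/
def sphere (k : ℕ) (φ : List (Finset ℕ × Finset ℕ) → ZMod 2) : ZMod 2 :=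
  hemisphere k φ + hemisphere k (fun w => φ (w.map Prod.swap))

theorem sphere_add (k : ℕ) (φ ψ : List (Finset ℕ × Finset ℕ) → ZMod 2) :
    sphere k (fun w => φ w + ψ w) = sphere k φ + sphere k ψ := by
  simp only [sphere, hemisphere_add]; ring

theorem hemisphere_succ (k : ℕ) (φ : List (Finset ℕ × Finset ℕ) → ZMod 2) :
    hemisphere (k + 1) φ = sphere k (Cochain.prism (addPos (k + 1)) φ) +
      sphere k (fun w => φ (({k + 1}, ∅) :: w.map (addPos (k + 1)))) := by
  rw [← sphere_add]; rfl

theorem sphere_swap (k : ℕ) (φ : List (Finset ℕ × Finset ℕ) → ZMod 2) :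
    sphere k (fun w => φ (w.map Prod.swap)) = sphere k φ := by
  simp [sphere, add_comm]

/-- Stokes: collar and cap share the pushed-up sphere, which cancels, so only the equator remains.
The hypothesis that the sphere is a cycle removes the terms from the boundary of the base. -/
theorem hemisphere_succ_coboundary_of_sphere (k : ℕ)
    (h : ∀ φ, sphere k (Cochain.coboundary φ) = 0) (φ : List (Finset ℕ × Finset ℕ) → ZMod 2) :
    hemisphere (k + 1) (Cochain.coboundary φ) = sphere k φ := by
  rw [hemisphere_succ]
  have h1 : Cochain.prism (addPos (k + 1)) (Cochain.coboundary φ) = fun w =>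
      (φ w + φ (w.map (addPos (k + 1)))) +
        Cochain.coboundary (Cochain.prism (addPos (k + 1)) φ) w :=
    funext fun w => Cochain.prism_homotopy _ _ _
  have h2 : (fun w : List (Finset ℕ × Finset ℕ) =>
        Cochain.coboundary φ (({k + 1}, ∅) :: w.map (addPos (k + 1)))) = fun w =>
      φ (w.map (addPos (k + 1))) +
        Cochain.coboundary (fun u => φ (({k + 1}, ∅) :: u.map (addPos (k + 1)))) w := by
    funext w
    rw [Cochain.coboundary_map (addPos (k + 1)) (fun u => φ (({k + 1}, ∅) :: u))]
    rfl
  rw [h1, h2, sphere_add, sphere_add, sphere_add, h, h]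
  have h2 : (2 : ZMod 2) = 0 := rfl
  linear_combination (sphere k fun w => φ (w.map (addPos (k + 1)))) * h2

/-- The two hemispheres have the same boundary, as the equator is invariant under the antipodal map.
-/
theorem sphere_coboundary (k : ℕ) (φ : List (Finset ℕ × Finset ℕ) → ZMod 2) :
    sphere k (Cochain.coboundary φ) = 0 := by
  induction k generalizing φ with
  | zero =>
    simp [sphere, hemisphere, Cochain.coboundary, CharTwo.add_self_eq_zero]
  | succ k ih =>
    rw [sphere, hemisphere_succ_coboundary_of_sphere k ih]
    simp only [← Cochain.coboundary_map]
    rw [hemisphere_succ_coboundary_of_sphere k ih, sphere_swap]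
    exact CharTwo.add_self_eq_zero _

theorem hemisphere_succ_coboundary (k : ℕ) (φ : List (Finset ℕ × Finset ℕ) → ZMod 2) :
    hemisphere (k + 1) (Cochain.coboundary φ) = sphere k φ :=
  hemisphere_succ_coboundary_of_sphere k (sphere_coboundary k) φ

/-- The prism over a chain consists of chains. -/
theorem prism_eq_zero_of_chain {V : Type*} [Preorder V] {f : V → V} (hf : Monotone f)
    (hle : ∀ v, v ≤ f v) (φ : List V → ZMod 2) {w : List V} (hw : w.Pairwise (· ≤ ·))
    (h : ∀ u : List V, u.length = w.length + 1 → u.Pairwise (· ≤ ·) →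
      (∀ v ∈ u, v ∈ w ∨ v ∈ w.map f) → φ u = 0) :
    Cochain.prism f φ w = 0 := by
  induction w generalizing φ with
  | nil => rfl
  | cons v w ih =>
    rw [List.pairwise_cons] at hw
    have hmap : (w.map f).Pairwise (· ≤ ·) :=
      List.pairwise_map.2 (hw.2.imp fun h => hf h)
    simp only [Cochain.prism]
    rw [h, ih _ hw.2, add_zero]
    · intro u hlen hu hmem
      refine h _ (by simp [hlen]) (List.pairwise_cons.2 ⟨fun x hx => ?_, hu⟩) ?_
      · rcases hmem x hx with hx | hx
        · exact hw.1 x hx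
        · obtain ⟨y, hy, rfl⟩ := List.mem_map.1 hx
          exact (hw.1 y hy).trans (hle y)
      · intro x hx
        rcases List.mem_cons.1 hx with rfl | hx
        · simp
        · rcases hmem x hx with hx | hx
          · exact Or.inl (List.mem_cons_of_mem _ hx)
          · exact Or.inr (by rw [List.map_cons]; exact List.mem_cons_of_mem _ hx)
    · simp
    · refine List.pairwise_cons.2 ⟨fun x hx => ?_, List.pairwise_cons.2 ⟨fun x hx => ?_, hmap⟩⟩
      · rcases List.mem_cons.1 hx with rfl | hx
        · exact hle _
        · obtain ⟨y, hy, rfl⟩ := List.mem_map.1 hx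
          exact (hw.1 y hy).trans (hle y)
      · obtain ⟨y, hy, rfl⟩ := List.mem_map.1 hx
        exact hf (hw.1 y hy)
    · intro x hx
      rcases List.mem_cons.1 hx with rfl | hx
      · simp
      · exact Or.inr (by simpa using hx)

theorem IsSignedChain.map_swap {k : ℕ} {w : List (Finset ℕ × Finset ℕ)}
    (h : IsSignedChain k w) : IsSignedChain k (w.map Prod.swap) := by
  obtain ⟨h1, h2, h3⟩ := h
  refine ⟨by simpa using h1, List.pairwise_map.2 (h2.imp fun h => ⟨h.2, h.1⟩), ?_⟩
  intro v hv
  obtain ⟨u, hu, rfl⟩ := List.mem_map.1 hv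
  exact (h3 u hu).swap

theorem hemisphere_eq_zero (k : ℕ) (φ : List (Finset ℕ × Finset ℕ) → ZMod 2)
    (h : ∀ w, IsSignedChain k w → φ w = 0) : hemisphere k φ = 0 := by
  induction k generalizing φ with
  | zero =>
    refine h _ ⟨rfl, by simp, ?_⟩
    simp [IsSignedSet]
  | succ k ih =>
    have key : ∀ w, IsSignedChain k w → Cochain.prism (addPos (k + 1)) φ w +
        φ (({k + 1}, ∅) :: w.map (addPos (k + 1))) = 0 := by
      intro w hw
      obtain ⟨h1, h2, h3⟩ := hw
      have hmap : ∀ v ∈ w.map (addPos (k + 1)), IsSignedSet (k + 1) v := by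
        intro v hv
        obtain ⟨u, hu, rfl⟩ := List.mem_map.1 hv
        exact (h3 u hu).addPos
      rw [prism_eq_zero_of_chain (fun _ _ => addPos_mono (k + 1)) (le_addPos (k + 1)) φ h2, h,
        add_zero]
      · refine ⟨by simp [h1], List.pairwise_cons.2 ⟨?_, ?_⟩, ?_⟩
        · intro v hv
          obtain ⟨u, hu, rfl⟩ := List.mem_map.1 hv
          exact ⟨by simp [addPos], by simp⟩
        · exact List.pairwise_map.2 (h2.imp fun h => addPos_mono _ h)
        · intro v hv
          rcases List.mem_cons.1 hv with rfl | hv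
          · simp [IsSignedSet]
          · exact hmap v hv
      · intro u hlen hu hmem
        refine h u ⟨by rw [hlen, h1], hu, fun v hv => ?_⟩
        rcases hmem v hv with hv | hv
        · exact (h3 v hv).mono (Nat.le_succ k)
        · exact hmap v hv
    simp only [hemisphere]
    rw [ih _ key, ih _ fun w hw => key _ hw.map_swap, add_zero]

theorem hemisphere_congr (k : ℕ) {φ ψ : List (Finset ℕ × Finset ℕ) → ZMod 2}
    (h : ∀ w, IsSignedChain k w → φ w = ψ w) : hemisphere k φ = hemisphere k ψ := by
  have h1 : hemisphere k (fun w => φ w + ψ w) = 0 :=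
    hemisphere_eq_zero k _ fun w hw => by rw [h w hw]; exact CharTwo.add_self_eq_zero _
  rw [hemisphere_add] at h1
  exact CharTwo.add_eq_zero.1 h1

theorem alternating_map_swap {s : Finset ℕ × Finset ℕ → Bool} (b : Bool)
    {w : List (Finset ℕ × Finset ℕ)} (hs : ∀ v ∈ w, s v.swap = !s v) :
    Cochain.alternating s b (w.map Prod.swap) = Cochain.alternating s (!b) w := by
  induction w generalizing b with
  | nil => rfl
  | cons v w ih =>
    simp only [List.map_cons, Cochain.alternating, hs v (by simp)]
    rw [ih _ fun u hu => hs u (List.mem_cons_of_mem _ hu)]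
    cases s v <;> cases b <;> rfl

/-- The sum is the coboundary of an alternating cochain, so Stokes moves it to the equator. There
antipodality turns the lower hemisphere with `b` into the upper one with `!b`, which is the same sum
one dimension lower. -/
theorem hemisphere_alternating (k : ℕ) {s : Finset ℕ × Finset ℕ → Bool}
    (hs : ∀ v, IsSignedSet k v → s v.swap = !s v) (b : Bool) :
    hemisphere k (Cochain.alternating s b) + hemisphere k (Cochain.alternating s (!b)) = 1 := by
  induction k with
  | zero =>
    simp only [hemisphere, Cochain.alternating]
    cases s ({0}, ∅) <;> cases b <;> simp
  | succ k ih =>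
    have hs' : ∀ v, IsSignedSet k v → s v.swap = !s v := fun v hv => hs v (hv.mono (Nat.le_succ k))
    rw [← hemisphere_add, ← ih hs']
    simp only [← Cochain.coboundary_alternating]
    have := hemisphere_succ_coboundary k (Cochain.alternating s b)
    rw [show (fun w => Cochain.coboundary (Cochain.alternating s b) w) =
      Cochain.coboundary (Cochain.alternating s b) from rfl, this, sphere]
    congr 1
    exact hemisphere_congr k fun w hw => alternating_map_swap b fun v hv => hs' v (hw.2.2 v hv)

theorem isChain_ne_of_alternating {V : Type*} {s : V → Bool} {b : Bool} {w : List V}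
    (h : Cochain.alternating s b w ≠ 0) : w.IsChain (fun u v => s u ≠ s v) := by
  induction w generalizing b with
  | nil => simp
  | cons v w ih =>
    simp only [Cochain.alternating, ne_eq, ite_eq_right_iff, Classical.not_imp] at h
    obtain ⟨h1, h2⟩ := h
    cases w with
    | nil => simp
    | cons u w =>
      refine List.isChain_cons_cons.2 ⟨?_, ih h2⟩
      simp only [Cochain.alternating, ite_eq_right_iff, Classical.not_imp] at h2
      rw [h1, h2.1]; cases b <;> simp

/-- An antipodal two-colouring of the signed sets with coordinates in `{0, …, k}` alternates along
some chain of length `k + 1`. This is a form of the lemmas of Tucker and Ky Fan. -/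
theorem exists_alternating_chain (k : ℕ) {s : Finset ℕ × Finset ℕ → Bool}
    (hs : ∀ v, IsSignedSet k v → s v.swap = !s v) :
    ∃ w, IsSignedChain k w ∧ w.IsChain (fun u v => s u ≠ s v) := by
  by_contra! hcon
  have h0 : ∀ b, hemisphere k (Cochain.alternating s b) = 0 := fun b =>
    hemisphere_eq_zero k _ fun w hw => by
      by_contra hne
      exact hcon w hw (isChain_ne_of_alternating hne)
  have := hemisphere_alternating k hs true
  rw [h0, h0] at this
  exact absurd this (by decide)

/-! ### Monochromatic disjoint sets -/

namespace Kneser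

/-- The number of elements of a signed set. -/
def size (v : Finset ℕ × Finset ℕ) : ℕ := v.1.card + v.2.card

/-- The greatest colour of a set with at least `k` elements inside one of the two parts. -/
def maxColor (k : ℕ) (c : Finset ℕ → ℕ) (v : Finset ℕ × Finset ℕ) : ℕ :=
  ((v.1.powerset ∪ v.2.powerset).filter (fun F => k ≤ F.card)).sup c

open Classical in
/-- The sign of a signed set: the part that attains the greatest colour or, if the set is too
small, the part that has the least element. -/
noncomputable def sign (k : ℕ) (c : Finset ℕ → ℕ) (v : Finset ℕ × Finset ℕ) : Bool :=
  if 2 * k ≤ size v + 1 then decide (∃ F ⊆ v.1, k ≤ F.card ∧ c F = maxColor k c v)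
  else decide (∃ a ∈ v.1, ∀ b ∈ v.2, a < b)

/-- A rank that increases strictly along inclusions that change the sign. -/
def rank (k : ℕ) (c : Finset ℕ → ℕ) (v : Finset ℕ × Finset ℕ) : ℕ :=
  if 2 * k ≤ size v + 1 then 2 * k - 1 + maxColor k c v else size v

variable {k : ℕ} {c : Finset ℕ → ℕ} {u v : Finset ℕ × Finset ℕ}

theorem size_swap (v : Finset ℕ × Finset ℕ) : size v.swap = size v := by
  simp [size, add_comm]

theorem maxColor_swap (v : Finset ℕ × Finset ℕ) : maxColor k c v.swap = maxColor k c v := by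
  simp [maxColor, Finset.union_comm]

theorem size_lt (h : u ≤ v) (hne : u ≠ v) : size u < size v := by
  by_contra hcon
  have h1 := Finset.card_le_card h.1
  have h2 := Finset.card_le_card h.2
  simp only [size] at hcon
  exact hne (Prod.ext (Finset.eq_of_subset_of_card_le h.1 (by omega))
    (Finset.eq_of_subset_of_card_le h.2 (by omega)))

theorem maxColor_mono (h : u ≤ v) : maxColor k c u ≤ maxColor k c v := by
  refine Finset.sup_mono (Finset.filter_subset_filter _ ?_)
  exact Finset.union_subset_union (Finset.powerset_mono.2 h.1) (Finset.powerset_mono.2 h.2)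

theorem exists_eq_maxColor (h : 2 * k ≤ size v + 1) :
    ∃ F, (F ⊆ v.1 ∨ F ⊆ v.2) ∧ k ≤ F.card ∧ c F = maxColor k c v := by
  have hne : ((v.1.powerset ∪ v.2.powerset).filter (fun F => k ≤ F.card)).Nonempty := by
    simp only [size] at h
    rcases le_or_gt k v.1.card with h1 | h1
    · exact ⟨v.1, by simp [h1]⟩
    · exact ⟨v.2, by simp; omega⟩
  obtain ⟨F, hF, hc⟩ := Finset.exists_mem_eq_sup _ hne c
  simp only [Finset.mem_filter, Finset.mem_union, Finset.mem_powerset] at hF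
  exact ⟨F, hF.1, hF.2, hc.symm⟩

/-- No two disjoint sets with at least `k` elements below `n` have the same colour. -/
def IsProper (n k : ℕ) (c : Finset ℕ → ℕ) : Prop :=
  ∀ F G : Finset ℕ, F ⊆ Finset.range n → G ⊆ Finset.range n → Disjoint F G → k ≤ F.card →
    k ≤ G.card → c F ≠ c G

/-- Exactly one part decides the sign: properness forbids that disjoint parts both attain the
greatest colour, and the least element lies in one part only. -/
theorem sign_swap {d : ℕ} (hc : IsProper (d + 1) k c) (hv : IsSignedSet d v) :
    sign k c v.swap = !sign k c v := by
  classical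
  obtain ⟨h1, h2, h3⟩ := hv
  rw [Bool.eq_not]
  simp only [sign, size_swap, maxColor_swap, Prod.fst_swap, Prod.snd_swap]
  split_ifs with h
  · rw [Ne, decide_eq_decide]
    obtain ⟨F, hF, hk, hm⟩ := exists_eq_maxColor (c := c) h
    intro hiff
    have hboth : (∃ F ⊆ v.1, k ≤ F.card ∧ c F = maxColor k c v) ∧
        (∃ F ⊆ v.2, k ≤ F.card ∧ c F = maxColor k c v) := by
      rcases hF with hF | hF
      · exact ⟨⟨F, hF, hk, hm⟩, hiff.2 ⟨F, hF, hk, hm⟩⟩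
      · exact ⟨hiff.1 ⟨F, hF, hk, hm⟩, ⟨F, hF, hk, hm⟩⟩
    obtain ⟨⟨F, hF, hk, hm⟩, ⟨G, hG, hk', hm'⟩⟩ := hboth
    exact hc F G (hF.trans (Finset.subset_union_left.trans h2))
      (hG.trans (Finset.subset_union_right.trans h2)) (h1.mono hF hG) hk hk' (hm.trans hm'.symm)
  · rw [Ne, decide_eq_decide]
    intro hiff
    have hmin := Finset.min'_mem _ h3
    have hle : ∀ x ∈ v.1 ∪ v.2, (v.1 ∪ v.2).min' h3 ≤ x := fun x hx => Finset.min'_le _ _ hx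
    set a := (v.1 ∪ v.2).min' h3
    have hboth : (∃ a ∈ v.1, ∀ b ∈ v.2, a < b) ∧ (∃ a ∈ v.2, ∀ b ∈ v.1, a < b) := by
      rcases Finset.mem_union.1 hmin with ha | ha
      · have : ∃ a ∈ v.1, ∀ b ∈ v.2, a < b := ⟨a, ha, fun b hb =>
          lt_of_le_of_ne (hle b (Finset.mem_union_right _ hb))
            (Finset.disjoint_left.1 h1 ha <| · ▸ hb)⟩
        exact ⟨this, hiff.2 this⟩
      · have : ∃ a ∈ v.2, ∀ b ∈ v.1, a < b := ⟨a, ha, fun b hb =>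
          lt_of_le_of_ne (hle b (Finset.mem_union_left _ hb))
            (Finset.disjoint_right.1 h1 ha <| · ▸ hb)⟩
        exact ⟨hiff.1 this, this⟩
    obtain ⟨⟨x, hx, hx'⟩, ⟨y, hy, hy'⟩⟩ := hboth
    exact lt_asymm (hx' y hy) (hy' x hx)

theorem rank_lt {d : ℕ} (hc : IsProper (d + 1) k c) (hv : IsSignedSet d v) (h : u ≤ v)
    (hs : sign k c u ≠ sign k c v) : rank k c u < rank k c v := by
  classical
  have hsize := size_lt h (fun e => hs (by rw [e]))
  simp only [rank]
  split_ifs with hu hv' hv'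
  -- If the greatest colour did not grow, a set attaining it in `u` would attain it in the same part
  -- of `v`, and the sign would not change.
  · refine Nat.add_lt_add_left (lt_of_le_of_ne (maxColor_mono h) fun heq => hs ?_) _
    obtain ⟨F, hF, hk, hm⟩ := exists_eq_maxColor (c := c) hu
    have hnot : ∀ {F G : Finset ℕ}, F ⊆ v.1 → G ⊆ v.2 → k ≤ F.card → k ≤ G.card → c F ≠ c G :=
      fun hF hG => hc _ _ (hF.trans (Finset.subset_union_left.trans hv.2.1))
        (hG.trans (Finset.subset_union_right.trans hv.2.1)) (hv.1.mono hF hG)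
    simp only [sign, if_pos hu, if_pos hv', decide_eq_decide]
    rcases hF with hF | hF
    · exact iff_of_true ⟨F, hF, hk, hm⟩ ⟨F, hF.trans h.1, hk, hm.trans heq⟩
    · refine iff_of_false ?_ ?_
      · rintro ⟨G, hG, hk', hm'⟩
        exact hnot (hG.trans h.1) (hF.trans h.2) hk' hk (hm'.trans hm.symm)
      · rintro ⟨G, hG, hk', hm'⟩
        exact hnot hG (hF.trans h.2) hk' hk (hm'.trans (hm.trans heq).symm)
  · omega
  · omega
  · exact hsize

end Kneser

/-- The Lovász–Kneser theorem. -/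
theorem exists_disjoint_monochromatic {n k r : ℕ} (hk : 1 ≤ k) (hn : 2 * k + r ≤ n + 1)
    (c : Finset ℕ → ℕ) (hr : ∀ F, c F < r) :
    ∃ F G : Finset ℕ, F ⊆ Finset.range n ∧ G ⊆ Finset.range n ∧ Disjoint F G ∧ k ≤ F.card ∧
      k ≤ G.card ∧ c F = c G := by
  by_contra! hcon
  have hr0 := hr ∅
  obtain ⟨d, rfl⟩ : ∃ d, n = d + 1 := ⟨n - 1, by omega⟩
  have hc : Kneser.IsProper (d + 1) k c := hcon
  obtain ⟨w, ⟨hlen, hle, hmem⟩, halt⟩ :=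
    exists_alternating_chain d (s := Kneser.sign k c) fun v hv => Kneser.sign_swap hc hv
  have hchain : (w.map (Kneser.rank k c)).IsChain (· < ·) := by
    rw [List.isChain_map]
    clear hlen
    induction w with
    | nil => simp
    | cons u w ih =>
      cases w with
      | nil => simp
      | cons v w =>
        rw [List.isChain_cons_cons] at halt ⊢
        rw [List.pairwise_cons] at hle
        exact ⟨Kneser.rank_lt hc (hmem v (by simp)) (hle.1 v (by simp)) halt.1,
          ih halt.2 hle.2 fun x hx => hmem x (List.mem_cons_of_mem _ hx)⟩
  have hnodup : (w.map (Kneser.rank k c)).Nodup :=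
    (List.isChain_iff_pairwise.1 hchain).imp fun h => h.ne
  -- Small signed sets have ranks from 1 to 2k - 2, the others from 2k - 1 to 2k + r - 2. The n ≥ 2k
  -- + r - 1 members of the chain have distinct ranks, one too many.
  have hsub : (w.map (Kneser.rank k c)).toFinset ⊆ Finset.Icc 1 (2 * k + r - 2) := by
    intro x hx
    obtain ⟨v, hv, rfl⟩ := List.mem_map.1 (List.mem_toFinset.1 hx)
    have hpos : 1 ≤ Kneser.size v := by
      have := (hmem v hv).2.2.card_pos
      have := Finset.card_union_le v.1 v.2
      simp only [Kneser.size]; omega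
    have hmax : Kneser.maxColor k c v < r := by
      rw [Kneser.maxColor, Finset.sup_lt_iff (bot_le.trans_lt hr0)]
      exact fun F _ => hr F
    simp only [Kneser.rank, Finset.mem_Icc]
    split_ifs <;> omega
  have := Finset.card_le_card hsub
  rw [List.toFinset_card_of_nodup hnodup, List.length_map, hlen, Nat.card_Icc] at this
  omega

/-! ### Densities of sets of integers -/

/-- The density of the nonnegative part of `B` is at most `ε`, with a bounded error. -/
def HasDensityLE (B : Set ℤ) (ε : ℝ) : Prop :=
  ∃ C : ℝ, ∀ n : ℕ, ((B ∩ Set.Ico 0 (n : ℤ)).ncard : ℝ) ≤ ε * n + C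

theorem HasDensityLE.mono {B B' : Set ℤ} {ε ε' : ℝ} (h : HasDensityLE B ε) (hB : B' ⊆ B)
    (hε : ε ≤ ε') : HasDensityLE B' ε' := by
  obtain ⟨C, hC⟩ := h
  refine ⟨C, fun n => le_trans ?_ ((hC n).trans ?_)⟩
  · exact_mod_cast Set.ncard_le_ncard (Set.inter_subset_inter_left _ hB)
      ((Set.finite_Ico _ _).inter_of_right _)
  · gcongr

theorem HasDensityLE.union {B B' : Set ℤ} {ε ε' : ℝ} (h : HasDensityLE B ε)
    (h' : HasDensityLE B' ε') : HasDensityLE (B ∪ B') (ε + ε') := by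
  obtain ⟨C, hC⟩ := h
  obtain ⟨C', hC'⟩ := h'
  refine ⟨C + C', fun n => ?_⟩
  have h1 : (((B ∪ B') ∩ Set.Ico 0 (n : ℤ)).ncard : ℝ) ≤
      ((B ∩ Set.Ico 0 (n : ℤ)).ncard : ℝ) + ((B' ∩ Set.Ico 0 (n : ℤ)).ncard : ℝ) := by
    rw [Set.union_inter_distrib_right]
    exact_mod_cast Set.ncard_union_le _ _
  linarith [hC n, hC' n]

theorem hasDensityLE_empty : HasDensityLE ∅ 0 := ⟨0, by simp⟩

theorem hasDensityLE_univ : HasDensityLE Set.univ 1 :=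
  ⟨0, fun n => by simp [Set.ncard_eq_toFinset_card']⟩

theorem HasDensityLE.biUnion {ι : Type*} (I : Finset ι) {B : ι → Set ℤ} {ε : ι → ℝ}
    (h : ∀ i ∈ I, HasDensityLE (B i) (ε i)) : HasDensityLE (⋃ i ∈ I, B i) (∑ i ∈ I, ε i) := by
  classical
  induction I using Finset.induction_on with
  | empty => simpa using hasDensityLE_empty
  | insert a I ha ih =>
    rw [Finset.sum_insert ha, Finset.set_biUnion_insert]
    exact (h a (by simp)).union (ih fun i hi => h i (Finset.mem_insert_of_mem hi))

/-- Prescribing the residue modulo `M` and the integral quotient by `M`. -/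
theorem HasDensityLE.div_mod {B : Set ℤ} {ε δ : ℝ} (h : HasDensityLE B ε) (hε : 0 ≤ ε)
    {M : ℕ} (hM : 0 < M) (D : Finset ℤ) (hD : (D.card : ℝ) ≤ δ * M) :
    HasDensityLE {x : ℤ | x / M ∈ B ∧ x % M ∈ D} (ε * δ) := by
  obtain ⟨C, hC⟩ := h
  have hMr : (0 : ℝ) < M := by exact_mod_cast hM
  have hδ : 0 ≤ δ := by
    by_contra hneg
    have := mul_neg_of_neg_of_pos (not_le.1 hneg) hMr
    have h0 : (0 : ℝ) ≤ D.card := Nat.cast_nonneg _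
    linarith
  have hC0 : 0 ≤ C := by simpa using hC 0
  refine ⟨(ε + C) * (δ * M), fun n => ?_⟩
  -- Quotient and remainder determine `x`; the extra 1 accounts for the last incomplete block of
  -- length `M`.
  have hsub : ({x : ℤ | x / M ∈ B ∧ x % M ∈ D} ∩ Set.Ico 0 (n : ℤ)).ncard ≤
      ((B ∩ Set.Ico 0 ((n / M + 1 : ℕ) : ℤ)) ×ˢ (D : Set ℤ)).ncard := by
    refine Set.ncard_le_ncard_of_injOn (fun x => (x / M, x % M)) ?_ ?_
      (((Set.finite_Ico _ _).inter_of_right _).prod D.finite_toSet)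
    · rintro x ⟨⟨h1, h2⟩, h3, h4⟩
      refine ⟨⟨h1, Int.ediv_nonneg h3 (by positivity), ?_⟩, h2⟩
      have : x / (M : ℤ) ≤ (n : ℤ) / M := Int.ediv_le_ediv (by exact_mod_cast hM) h4.le
      push_cast
      omega
    · intro x _ y _ hxy
      simp only [Prod.mk.injEq] at hxy
      rw [← Int.emod_add_mul_ediv x M, ← Int.emod_add_mul_ediv y M, hxy.1, hxy.2]
  rw [Set.ncard_prod, Set.ncard_coe_finset] at hsub
  have hq : ((n / M : ℕ) : ℝ) ≤ n / M := Nat.cast_div_le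
  have h1 := hC (n / M + 1)
  have h2 : ε * ((n / M + 1 : ℕ) : ℝ) + C ≤ ε * (n / M + 1) + C := by
    push_cast; gcongr
  calc ((({x : ℤ | x / M ∈ B ∧ x % M ∈ D} ∩ Set.Ico 0 (n : ℤ)).ncard : ℕ) : ℝ)
      ≤ ((B ∩ Set.Ico 0 ((n / M + 1 : ℕ) : ℤ)).ncard : ℝ) * D.card := by exact_mod_cast hsub
    _ ≤ (ε * (n / M + 1) + C) * (δ * M) := by
        refine mul_le_mul (h1.trans h2) hD (Nat.cast_nonneg _) (by positivity)
    _ = ε * δ * n + (ε + C) * (δ * M) := by field_simp; ring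

theorem hasDensityLE_mod {δ : ℝ} {M : ℕ} (hM : 0 < M) (D : Finset ℤ)
    (hD : (D.card : ℝ) ≤ δ * M) : HasDensityLE {x | x % M ∈ D} δ := by
  simpa using hasDensityLE_univ.div_mod zero_le_one hM D hD

theorem HasDensityLE.div {B : Set ℤ} {ε : ℝ} (h : HasDensityLE B ε) (hε : 0 ≤ ε)
    {M : ℕ} (hM : 0 < M) : HasDensityLE {x | x / M ∈ B} ε := by
  have := h.div_mod hε hM (δ := 1) (Finset.Ico 0 (M : ℤ)) (by simp)
  refine this.mono (fun x hx => ⟨hx, ?_⟩) (by simp)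
  have hM' : (0 : ℤ) < M := by exact_mod_cast hM
  simp [Int.emod_nonneg x hM'.ne', Int.emod_lt_of_pos x hM']

/-! ### Digits -/

/-- The `i`-th digit of the integer `x` in base `M`. -/
def digit (M i : ℕ) (x : ℤ) : ℤ := x / (M : ℤ) ^ i % M

theorem digit_zero (M : ℕ) (x : ℤ) : digit M 0 x = x % M := by simp [digit]

theorem digit_succ (M i : ℕ) (x : ℤ) : digit M (i + 1) x = digit M i (x / M) := by
  simp only [digit]
  rw [pow_succ', Int.ediv_ediv_of_nonneg (Int.natCast_nonneg M)]

theorem digit_add_pow {M n i : ℕ} (hM : 0 < M) (hi : i < n) (x : ℤ) :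
    digit M i (x + (M : ℤ) ^ n) = digit M i x := by
  have hM' : (M : ℤ) ^ i ≠ 0 := by positivity
  obtain ⟨j, rfl⟩ : ∃ j, n = i + (j + 1) := ⟨n - i - 1, by omega⟩
  simp only [digit]
  rw [pow_add, Int.add_mul_ediv_left _ _ hM', pow_succ, Int.add_mul_emod_self_right]

/-- Adding a combination of powers of `M` with coefficients in `{-1, 0, 1}` produces no carry if no
digit is extreme. -/
theorem digit_add_sum {M n : ℕ} {e : ℕ → ℤ} (he : ∀ i, |e i| ≤ 1) {x : ℤ}
    (hx : ∀ i < n, 1 ≤ digit M i x ∧ digit M i x + 1 < M) {i : ℕ} (hi : i < n) :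
    digit M i (x + ∑ j ∈ Finset.range n, e j * (M : ℤ) ^ j) = digit M i x + e i := by
  induction n generalizing x e i with
  | zero => omega
  | succ n ih =>
    have h0 := hx 0 (by omega)
    rw [digit_zero] at h0
    have he0 := abs_le.1 (he 0)
    have hM : (0 : ℤ) < M := by omega
    have hsum : x + ∑ j ∈ Finset.range (n + 1), e j * (M : ℤ) ^ j =
        (x % M + e 0) + M * (x / M + ∑ j ∈ Finset.range n, e (j + 1) * (M : ℤ) ^ j) := by
      rw [Finset.sum_range_succ', mul_add, Finset.mul_sum]
      have h1 := Int.emod_add_mul_ediv x M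
      have h2 : ∑ j ∈ Finset.range n, e (j + 1) * (M : ℤ) ^ (j + 1) =
          ∑ j ∈ Finset.range n, (M : ℤ) * (e (j + 1) * (M : ℤ) ^ j) :=
        Finset.sum_congr rfl fun j _ => by ring
      rw [h2]
      linear_combination -h1
    rw [hsum]
    cases i with
    | zero =>
      rw [digit_zero, digit_zero, Int.add_mul_emod_self_left]
      exact Int.emod_eq_of_lt (by omega) (by omega)
    | succ i =>
      rw [digit_succ, digit_succ, Int.add_mul_ediv_left _ _ hM.ne',
        Int.ediv_eq_zero_of_lt (by omega) (by omega), zero_add]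
      refine ih (fun j => he (j + 1)) (fun j hj => ?_) (by omega)
      rw [← digit_succ]
      exact hx (j + 1) (by omega)

theorem hasDensityLE_digit_mem {M : ℕ} (hM : 0 < M) (i : ℕ) (D : Finset ℤ) {δ : ℝ}
    (hD : (D.card : ℝ) ≤ δ * M) : HasDensityLE {x | digit M i x ∈ D} δ := by
  have hδ : 0 ≤ δ := by
    by_contra hneg
    have := mul_neg_of_neg_of_pos (not_le.1 hneg) (show (0 : ℝ) < M by exact_mod_cast hM)
    have h0 : (0 : ℝ) ≤ D.card := Nat.cast_nonneg _
    linarith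
  have := (hasDensityLE_mod hM D hD).div hδ (M := M ^ i) (by positivity)
  simpa [digit] using this

/-- The positions below `n` of the odd digits of `x`. -/
def oddDigits (M n : ℕ) (x : ℤ) : Finset ℕ :=
  (Finset.range n).filter fun i => Odd (digit M i x)

theorem card_filter_odd (K : ℕ) (b : Bool) :
    ((Finset.Ico 0 ((2 * K : ℕ) : ℤ)).filter fun x => decide (Odd x) = b).card = K := by
  have : ((Finset.Ico 0 ((2 * K : ℕ) : ℤ)).filter fun x => decide (Odd x) = b) =
      (Finset.range K).image fun j : ℕ => 2 * (j : ℤ) + if b then 1 else 0 := by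
    ext x
    simp only [Finset.mem_filter, Finset.mem_Ico, Finset.mem_image, Finset.mem_range]
    constructor
    · rintro ⟨⟨h1, h2⟩, h3⟩
      refine ⟨(x / 2).toNat, by omega, ?_⟩
      cases b
      · simp at h3
        obtain ⟨y, rfl⟩ := h3
        simp; omega
      · simp at h3
        obtain ⟨y, rfl⟩ := h3
        simp; omega
    · rintro ⟨j, hj, rfl⟩
      cases b <;> simp <;> omega
  rw [this, Finset.card_image_of_injective, Finset.card_range]
  intro i j hij
  simpa using hij

theorem hasDensityLE_odd_digits {K : ℕ} (hK : 0 < K) (n : ℕ) (t : ℕ → Bool) :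
    HasDensityLE {x | ∀ i < n, decide (Odd (digit (2 * K) i x)) = t i} ((1 / 2) ^ n) := by
  induction n generalizing t with
  | zero => simpa using hasDensityLE_univ
  | succ n ih =>
    have h := (ih fun i => t (i + 1)).div_mod (by positivity) (M := 2 * K) (by omega) (δ := 1 / 2)
      ((Finset.Ico 0 ((2 * K : ℕ) : ℤ)).filter fun x => decide (Odd x) = t 0)
      (by rw [card_filter_odd]; push_cast; linarith)
    refine h.mono (fun x hx => ⟨fun i hi => ?_, ?_⟩) (by rw [pow_succ])
    · rw [← digit_succ]
      exact hx (i + 1) (by omega)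
    · have hpos : (0 : ℤ) < ((2 * K : ℕ) : ℤ) := by exact_mod_cast (by omega : 0 < 2 * K)
      have := hx 0 (by omega)
      rw [digit_zero] at this
      simp only [Finset.mem_filter, Finset.mem_Ico]
      exact ⟨⟨Int.emod_nonneg x hpos.ne', Int.emod_lt_of_pos x hpos⟩, this⟩

theorem hasDensityLE_oddDigits_eq {K : ℕ} (hK : 0 < K) (n : ℕ) (T : Finset ℕ) :
    HasDensityLE {x | oddDigits (2 * K) n x = T} ((1 / 2) ^ n) := by
  refine (hasDensityLE_odd_digits hK n fun i => decide (i ∈ T)).mono (fun x hx i hi => ?_) le_rfl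
  have hx' : oddDigits (2 * K) n x = T := hx
  rw [← hx', decide_eq_decide]
  simp [oddDigits, hi]

/-! ### Central binomial coefficients -/

/-- The induction rests on (2N + 1)(2N + 3) ≤ 4(N + 1)². The bound shows that the middle layer of
the 2N-cube has vanishing proportion. -/
theorem centralBinom_sq_mul_le (N : ℕ) : N.centralBinom ^ 2 * (2 * N + 1) ≤ 16 ^ N := by
  induction N with
  | zero => simp
  | succ N ih =>
    have h := Nat.succ_mul_centralBinom_succ N
    refine Nat.le_of_mul_le_mul_left ?_ (show 0 < (N + 1) ^ 2 by positivity)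
    calc (N + 1) ^ 2 * ((N + 1).centralBinom ^ 2 * (2 * (N + 1) + 1))
        = ((N + 1) * (N + 1).centralBinom) ^ 2 * (2 * N + 3) := by ring
      _ = 4 * ((2 * N + 1) * (2 * N + 3)) * (N.centralBinom ^ 2 * (2 * N + 1)) := by rw [h]; ring
      _ ≤ 4 * (4 * (N + 1) ^ 2) * 16 ^ N :=
        Nat.mul_le_mul (Nat.mul_le_mul_left 4 (by nlinarith)) ih
      _ = (N + 1) ^ 2 * 16 ^ (N + 1) := by ring

theorem exists_centralBinom_le {η : ℝ} (hη : 0 < η) (N₀ : ℕ) :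
    ∃ N ≥ N₀, (N.centralBinom : ℝ) * (1 / 2) ^ (2 * N) ≤ η := by
  obtain ⟨N₁, hN₁⟩ := exists_nat_gt (1 / η ^ 2)
  refine ⟨max N₀ N₁, le_max_left _ _, ?_⟩
  set N := max N₀ N₁
  have hN : 1 / η ^ 2 < N := hN₁.trans_le (by exact_mod_cast le_max_right _ _)
  refine abs_le_of_sq_le_sq' ?_ hη.le |>.2
  have h := centralBinom_sq_mul_le N
  have h' : (N.centralBinom : ℝ) ^ 2 * (2 * N + 1) ≤ 16 ^ N := by exact_mod_cast h
  have h2 : 1 ≤ η ^ 2 * (2 * N + 1) := by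
    rw [div_lt_iff₀ (by positivity)] at hN
    nlinarith [sq_nonneg η, (Nat.cast_nonneg N : (0 : ℝ) ≤ N)]
  have h16 : ((1 / 2 : ℝ) ^ (2 * N)) ^ 2 * 16 ^ N = 1 := by
    rw [← pow_mul, mul_comm (2 * N) 2, ← mul_assoc, pow_mul, ← mul_pow]; norm_num
  have hp : (0 : ℝ) < (1 / 2 : ℝ) ^ (2 * N) := by positivity
  have h3 : (N.centralBinom : ℝ) ^ 2 ≤ η ^ 2 * 16 ^ N := by
    have hpos : (0 : ℝ) < 2 * N + 1 := by positivity
    refine le_of_mul_le_mul_right (h'.trans ?_) hpos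
    calc (16 : ℝ) ^ N = 1 * 16 ^ N := by ring
      _ ≤ (η ^ 2 * (2 * N + 1)) * 16 ^ N := by gcongr
      _ = _ := by ring
  calc ((N.centralBinom : ℝ) * (1 / 2) ^ (2 * N)) ^ 2
      = (N.centralBinom : ℝ) ^ 2 * ((1 / 2 : ℝ) ^ (2 * N)) ^ 2 := by ring
    _ ≤ (η ^ 2 * 16 ^ N) * ((1 / 2 : ℝ) ^ (2 * N)) ^ 2 := by gcongr
    _ = η ^ 2 * (((1 / 2 : ℝ) ^ (2 * N)) ^ 2 * 16 ^ N) := by ring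
    _ = η ^ 2 := by rw [h16, mul_one]

theorem card_near_middle_le (N r : ℕ) :
    ((Finset.range (2 * N)).powerset.filter fun T => N ≤ T.card + r ∧ T.card ≤ N + r).card ≤
      (2 * r + 1) * N.centralBinom := by
  have hsub : ((Finset.range (2 * N)).powerset.filter
      fun T => N ≤ T.card + r ∧ T.card ≤ N + r) ⊆
      (Finset.Icc (N - r) (N + r)).biUnion fun w => (Finset.range (2 * N)).powersetCard w := by
    intro T hT
    simp only [Finset.mem_filter, Finset.mem_powerset] at hT
    simp only [Finset.mem_biUnion, Finset.mem_Icc, Finset.mem_powersetCard]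
    exact ⟨T.card, by omega, hT.1, rfl⟩
  refine (Finset.card_le_card hsub).trans (Finset.card_biUnion_le.trans ?_)
  refine (Finset.sum_le_card_nsmul _ _ N.centralBinom fun w _ => ?_).trans ?_
  · rw [Finset.card_powersetCard, Finset.card_range]
    exact Nat.choose_le_centralBinom w N
  · rw [smul_eq_mul, Nat.card_Icc]
    exact Nat.mul_le_mul_right _ (by omega)

/-! ### Finite pieces -/

/-- Every colouring of the integers with `r` colours has two integers of the same colour whose
difference is in `F`. -/
def IsChromaticFor (r : ℕ) (F : Set ℤ) : Prop :=
  ∀ χ : ℤ → ℕ, (∀ x, χ x < r) → ∃ x y, χ x = χ y ∧ x - y ∈ F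

/-- Up to a set of density at most `ε`, the Cayley graph of `F` on the integers is bipartite with
periodic classes. -/
def IsNearlyBipartite (F : Set ℤ) (ε : ℝ) : Prop :=
  ∃ (m : ℕ) (g : ℤ → Bool) (B : Set ℤ), 0 < m ∧ (∀ x, g (x + m) = g x) ∧ HasDensityLE B ε ∧
    ∀ s ∈ F, ∀ x, x ∉ B → x + s ∉ B → g (x + s) = !g x

/-- Combinations of the first `n` powers of `M` with coefficients in `{-1, 0, 1}`, of which at most
`d` vanish. -/
def signedSums (M n d : ℕ) : Set ℤ :=
  {s | ∃ e : ℕ → ℤ, (∀ i, |e i| ≤ 1) ∧ ((Finset.range n).filter fun i => e i = 0).card ≤ d ∧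
    s = ∑ i ∈ Finset.range n, e i * (M : ℤ) ^ i}

theorem abs_le_of_mem_signedSums {M n d : ℕ} {s : ℤ} (hs : s ∈ signedSums M n d) :
    |s| ≤ ∑ i ∈ Finset.range n, (M : ℤ) ^ i := by
  obtain ⟨e, he, -, rfl⟩ := hs
  refine (Finset.abs_sum_le_sum_abs _ _).trans (Finset.sum_le_sum fun i _ => ?_)
  rw [abs_mul, abs_of_nonneg (by positivity : (0 : ℤ) ≤ (M : ℤ) ^ i)]
  exact mul_le_of_le_one_left (by positivity) (he i)

theorem isChromaticFor_signedSums (M : ℕ) {k : ℕ} (hk : 1 ≤ k) (r : ℕ) :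
    IsChromaticFor r (signedSums M (2 * k + 2 * r) (2 * r)) := by
  intro χ hχ
  obtain ⟨F, G, hF, hG, hd, hFk, hGk, hFG⟩ := exists_disjoint_monochromatic hk
    (show 2 * k + r ≤ (2 * k + 2 * r) + 1 by omega)
    (fun F => χ (∑ i ∈ F, (M : ℤ) ^ i)) (fun F => hχ _)
  refine ⟨_, _, hFG, fun i => (if i ∈ F then 1 else 0) - if i ∈ G then 1 else 0, ?_, ?_, ?_⟩
  · intro i
    dsimp only
    split_ifs <;> simp
  · have hsub : ((Finset.range (2 * k + 2 * r)).filter fun i =>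
        ((if i ∈ F then 1 else 0) - if i ∈ G then 1 else 0 : ℤ) = 0) ⊆
        Finset.range (2 * k + 2 * r) \ (F ∪ G) := by
      intro i hi
      simp only [Finset.mem_filter, Finset.mem_sdiff, Finset.mem_union] at hi ⊢
      refine ⟨hi.1, fun h => ?_⟩
      rcases h with h | h
      · have := Finset.disjoint_left.1 hd h
        simp [h, this] at hi
      · have := Finset.disjoint_right.1 hd h
        simp [h, this] at hi
    refine (Finset.card_le_card hsub).trans ?_
    rw [Finset.card_sdiff_of_subset (Finset.union_subset hF hG), Finset.card_union_of_disjoint hd,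
      Finset.card_range]
    omega
  · simp only [sub_mul, ite_mul, one_mul, zero_mul, Finset.sum_sub_distrib, Finset.sum_ite_mem]
    rw [Finset.inter_eq_right.2 hF, Finset.inter_eq_right.2 hG]

theorem isNearlyBipartite_signedSums {K : ℕ} (hK : 0 < K) (N r : ℕ) :
    IsNearlyBipartite (signedSums (2 * K) (2 * N) (2 * r))
      (2 * N * (1 / K) + (2 * r + 1) * (N.centralBinom * (1 / 2) ^ (2 * N))) := by
  have hKr : (0 : ℝ) < K := by exact_mod_cast hK
  set M := 2 * K with hM
  set B₁ : Set ℤ := ⋃ i ∈ Finset.range (2 * N), {x | digit M i x ∈ ({0, (M : ℤ) - 1} : Finset ℤ)}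
  set 𝒯 := (Finset.range (2 * N)).powerset.filter fun T => N ≤ T.card + r ∧ T.card ≤ N + r
  set B₂ : Set ℤ := ⋃ T ∈ 𝒯, {x | oddDigits M (2 * N) x = T}
  refine ⟨M ^ (2 * N), fun x => decide (N < (oddDigits M (2 * N) x).card), B₁ ∪ B₂, by positivity,
    fun x => ?_, ?_, ?_⟩
  · have : oddDigits M (2 * N) (x + (M ^ (2 * N) : ℕ)) = oddDigits M (2 * N) x := by
      refine Finset.filter_congr fun i hi => ?_
      push_cast
      rw [digit_add_pow (by omega) (Finset.mem_range.1 hi)]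
    simp only [this]
  · refine HasDensityLE.union ?_ ?_
    · refine (HasDensityLE.biUnion _ (ε := fun _ => 1 / (K : ℝ)) fun i _ =>
        hasDensityLE_digit_mem (by omega) i _ ?_).mono subset_rfl (by simp)
      have h2 : (({0, (M : ℤ) - 1} : Finset ℤ).card : ℝ) ≤ 2 := by
        exact_mod_cast Finset.card_le_two
      refine h2.trans (le_of_eq ?_)
      rw [hM]; push_cast; field_simp
    · refine (HasDensityLE.biUnion _ (ε := fun _ => (1 / 2 : ℝ) ^ (2 * N)) fun T _ =>
        hasDensityLE_oddDigits_eq hK (2 * N) T).mono subset_rfl ?_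
      rw [Finset.sum_const, nsmul_eq_mul, ← mul_assoc]
      gcongr
      exact_mod_cast card_near_middle_le N r
  · rintro s ⟨e, he, hcard, rfl⟩ x hx hy
    set y := x + ∑ i ∈ Finset.range (2 * N), e i * (M : ℤ) ^ i
    have hMpos : (0 : ℤ) < M := by exact_mod_cast (by omega : 0 < M)
    have hdig : ∀ i < 2 * N, 1 ≤ digit M i x ∧ digit M i x + 1 < M := by
      intro i hi
      have h0 : 0 ≤ digit M i x := Int.emod_nonneg _ hMpos.ne'
      have h1 : digit M i x < M := Int.emod_lt_of_pos _ hMpos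
      have h2 : digit M i x ∉ ({0, (M : ℤ) - 1} : Finset ℤ) := fun h =>
        hx (Or.inl (Set.mem_biUnion (Finset.mem_range.2 hi) h))
      simp only [Finset.mem_insert, Finset.mem_singleton, not_or] at h2
      omega
    have hnear : ∀ z, z ∉ B₁ ∪ B₂ → ¬ (N ≤ (oddDigits M (2 * N) z).card + r ∧
        (oddDigits M (2 * N) z).card ≤ N + r) := fun z hz h =>
      hz (Or.inr (Set.mem_biUnion (show oddDigits M (2 * N) z ∈ 𝒯 from
        Finset.mem_filter.2 ⟨Finset.mem_powerset.2 (Finset.filter_subset _ _), h⟩) rfl))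
    have hX := hnear x hx
    have hY := hnear y hy
    have hflip : ∀ i < 2 * N, e i ≠ 0 → (Odd (digit M i y) ↔ ¬ Odd (digit M i x)) := by
      intro i hi hne
      rw [digit_add_sum he hdig hi]
      have := abs_le.1 (he i)
      have : e i = 1 ∨ e i = -1 := by omega
      rcases this with h | h <;> rw [h] <;> simp only [Int.odd_iff] <;> omega
    set Z := (Finset.range (2 * N)).filter fun i => e i = 0
    have hunion : Finset.range (2 * N) \ Z ⊆ oddDigits M (2 * N) x ∪ oddDigits M (2 * N) y := by
      intro i hi
      simp only [Z, Finset.mem_sdiff, Finset.mem_filter, Finset.mem_range, not_and] at hi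
      have := hflip i hi.1 (hi.2 hi.1)
      simp only [oddDigits, Finset.mem_union, Finset.mem_filter, Finset.mem_range]
      tauto
    have hinter : oddDigits M (2 * N) x ∩ oddDigits M (2 * N) y ⊆ Z := by
      intro i hi
      simp only [oddDigits, Finset.mem_inter, Finset.mem_filter, Finset.mem_range] at hi
      simp only [Z, Finset.mem_filter, Finset.mem_range]
      refine ⟨hi.1.1, by_contra fun hne => ?_⟩
      exact (hflip i hi.1.1 hne).1 hi.2.2 hi.1.2
    have h1 := Finset.card_le_card hunion
    have h2 := Finset.card_le_card hinter
    have h3 := Finset.card_union_add_card_inter (oddDigits M (2 * N) x) (oddDigits M (2 * N) y)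
    have h4 : (oddDigits M (2 * N) x ∪ oddDigits M (2 * N) y).card ≤ 2 * N := by
      simpa [oddDigits] using Finset.card_le_card (Finset.union_subset
        (Finset.filter_subset (fun i => Odd (digit M i x)) (Finset.range (2 * N)))
        (Finset.filter_subset (fun i => Odd (digit M i y)) (Finset.range (2 * N))))
    have h5 := Finset.le_card_sdiff Z (Finset.range (2 * N))
    rw [Finset.card_range] at h5
    -- The two odd-digit counts add up to 2N with error at most 2r, and each is more than r away
    -- from N, so they lie on opposite sides of N.
    rw [Bool.eq_not, Ne, decide_eq_decide]
    omega

/-- Finite sets that are recurrent for `r` colours and have nearly bipartite Cayley graphs. -/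
theorem exists_isChromaticFor_isNearlyBipartite (r : ℕ) {ε : ℝ} (hε : 0 < ε) :
    ∃ (F : Set ℤ) (L : ℕ), IsChromaticFor r F ∧ (∀ s ∈ F, |s| ≤ L) ∧ IsNearlyBipartite F ε := by
  -- `N` makes the near-middle part at most ε / 2, and then `K`, depending on `N`, does so for the
  -- extreme digits. `N ≥ r + 1` leaves k = N - r ≥ 1 for the Kneser theorem.
  obtain ⟨N, hN, hbinom⟩ :=
    exists_centralBinom_le (η := ε / (2 * (2 * r + 1))) (by positivity) (r + 1)
  obtain ⟨K, hK⟩ := exists_nat_gt (4 * N / ε)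
  have hKr : (0 : ℝ) < K := lt_of_le_of_lt (by positivity) hK
  have hK0 : 0 < K := by exact_mod_cast hKr
  obtain ⟨k, rfl⟩ : ∃ k, N = k + r := ⟨N - r, by omega⟩
  refine ⟨signedSums (2 * K) (2 * (k + r)) (2 * r), ∑ i ∈ Finset.range (2 * (k + r)), (2 * K) ^ i,
    ?_, fun s hs => ?_, ?_⟩
  · rw [mul_add]
    exact isChromaticFor_signedSums _ (by omega) r
  · have := abs_le_of_mem_signedSums hs
    push_cast at this ⊢
    exact this
  · obtain ⟨m, g, B, hm, hg, hB, h⟩ := isNearlyBipartite_signedSums hK0 (k + r) r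
    refine ⟨m, g, B, hm, hg, hB.mono subset_rfl ?_, h⟩
    have h1 : 2 * ((k + r : ℕ) : ℝ) * (1 / K) ≤ ε / 2 := by
      rw [div_lt_iff₀ hε] at hK
      rw [mul_one_div, div_le_iff₀ hKr]
      linarith
    have h2 : (2 * (r : ℝ) + 1) * ((k + r).centralBinom * (1 / 2) ^ (2 * (k + r))) ≤ ε / 2 := by
      calc _ ≤ (2 * (r : ℝ) + 1) * (ε / (2 * (2 * r + 1))) := by gcongr
        _ = ε / 2 := by field_simp
    linarith

/-! ### Gluing by dilation -/

theorem IsChromaticFor.image_mul {r : ℕ} {F : Set ℤ} (h : IsChromaticFor r F) (M : ℤ) :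
    IsChromaticFor r ((M * ·) '' F) := by
  intro χ hχ
  obtain ⟨x, y, hxy, hF⟩ := h (fun x => χ (M * x)) fun x => hχ _
  exact ⟨M * x, M * y, hxy, x - y, hF, mul_sub _ _ _⟩

theorem HasDensityLE.exists_notMem {B : Set ℤ} {ε : ℝ} (h : HasDensityLE B ε) (hε : ε < 1) :
    ∃ x, x ∉ B := by
  by_contra! hB
  obtain ⟨C, hC⟩ := h
  obtain ⟨n, hn⟩ := exists_nat_gt (C / (1 - ε))
  have := hC n
  rw [Set.eq_univ_of_forall hB, Set.univ_inter, Set.ncard_eq_toFinset_card'] at this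
  simp only [Set.toFinset_Ico, Int.card_Ico, sub_zero, Int.toNat_natCast] at this
  rw [div_lt_iff₀ (by linarith)] at hn
  linarith

theorem IsNearlyBipartite.ne_zero {F : Set ℤ} {ε : ℝ} (h : IsNearlyBipartite F ε) (hε : ε < 1)
    {s : ℤ} (hs : s ∈ F) : s ≠ 0 := by
  rintro rfl
  obtain ⟨m, g, B, -, -, hB, hg⟩ := h
  obtain ⟨x, hx⟩ := hB.exists_notMem hε
  simpa using hg 0 hs x hx (by simpa using hx)

/-- A nearly bipartite set and a large dilate of another one have a nearly bipartite union. -/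
theorem IsNearlyBipartite.exists_union_image_mul {E F : Set ℤ} {ε ε' δ : ℝ} {L : ℕ}
    (hE : IsNearlyBipartite E ε) (hL : ∀ s ∈ E, |s| ≤ L) (hF : IsNearlyBipartite F ε')
    (hε' : 0 ≤ ε') (hδ : 0 < δ) (T : ℕ) :
    ∃ M : ℕ, T < M ∧ IsNearlyBipartite (E ∪ ((M : ℤ) * ·) '' F) (ε + ε' + δ) := by
  obtain ⟨m, g, B, hm, hg, hB, hE⟩ := hE
  obtain ⟨m', g', B', hm', hg', hB', hF⟩ := hF
  obtain ⟨q, hq⟩ := exists_nat_gt (T + 2 * L / δ)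
  have hqT : T < q := by
    have : (T : ℝ) < q := lt_of_le_of_lt (le_add_of_nonneg_right (by positivity)) hq
    exact_mod_cast this
  have hqL : 2 * (L : ℝ) ≤ δ * q := by
    have : 2 * (L : ℝ) / δ ≤ q := le_trans (le_add_of_nonneg_left (Nat.cast_nonneg T)) hq.le
    rw [div_le_iff₀ hδ] at this
    linarith
  have hqM : q ≤ m * q := Nat.le_mul_of_pos_left _ hm
  set M := m * q with hMdef
  have hM : 0 < M := by omega
  have hM' : (0 : ℤ) < M := by exact_mod_cast hM
  have hgM : ∀ x j : ℤ, g (x + M * j) = g x := by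
    intro x j
    have := (show Function.Periodic g (m : ℤ) from hg).int_mul (q * j)
    rw [hMdef, Nat.cast_mul, ← this x]
    congr 1
    push_cast
    ring
  -- Residues so close to a multiple of `M` that a shift by an element of `E` might change the
  -- quotient.
  set D : Finset ℤ := Finset.Ico 0 (L : ℤ) ∪ Finset.Ico ((M : ℤ) - L) M
  have hD : (D.card : ℝ) ≤ δ * M := by
    have h1 : D.card ≤ 2 * L := by
      refine (Finset.card_union_le _ _).trans ?_
      simp [two_mul]
    calc (D.card : ℝ) ≤ 2 * L := by exact_mod_cast h1
      _ ≤ δ * q := hqL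
      _ ≤ δ * M := by gcongr
  -- A shift from `E` flips `g` and keeps x / M; a shift by a multiple of `M` keeps `g`, because its
  -- period `m` divides `M`, and for dilates of `F` it flips `g'`.
  refine ⟨M, by omega, M * m', fun x => xor (g x) (g' (x / M)),
    (B ∪ {x | x / M ∈ B'}) ∪ {x | x % M ∈ D}, by positivity, fun x => ?_,
    (hB.union (hB'.div hε' hM)).union (hasDensityLE_mod hM D hD), ?_⟩
  · push_cast
    rw [hgM, Int.add_mul_ediv_left _ _ hM'.ne', hg']
  · rintro s hs x hx hy
    simp only [Set.mem_union, Set.mem_ofPred_eq, not_or] at hx hy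
    rcases hs with hs | ⟨s, hs, rfl⟩
    · have hdiv : (x + s) / M = x / M := by
        have h1 := hx.2
        have h2 := Int.emod_nonneg x hM'.ne'
        have h3 := Int.emod_lt_of_pos x hM'
        have h4 := abs_le.1 (hL s hs)
        simp only [D, Finset.mem_union, Finset.mem_Ico, not_or, not_and, not_lt] at h1
        have h5 := h1.1 h2
        have h6 : x % M < M - L := lt_of_not_ge fun h => absurd (h1.2 h) (by omega)
        have h7 : x + s = (x % M + s) + M * (x / M) := by
          have := Int.emod_add_mul_ediv x M
          linarith
        rw [h7, Int.add_mul_ediv_left _ _ hM'.ne', Int.ediv_eq_zero_of_lt (by omega) (by omega),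
          zero_add]
      dsimp only
      rw [hdiv, hE s hs x hx.1.1 hy.1.1, Bool.not_xor]
    · have h2 := hy.1.2
      dsimp only at h2 ⊢
      rw [Int.add_mul_ediv_left _ _ hM'.ne'] at h2 ⊢
      rw [hgM, hF s hs _ hx.1.2 h2, Bool.xor_not]

theorem IsNearlyBipartite.exists_union {E : Set ℤ} {ε η : ℝ} {L : ℕ}
    (hE : IsNearlyBipartite E ε) (hL : ∀ s ∈ E, |s| ≤ L) (hη : 0 < η) (hη1 : η ≤ 1) (r T : ℕ) :
    ∃ (S : Set ℤ) (L' : ℕ), IsChromaticFor r S ∧ (∀ s ∈ S, (T : ℤ) < |s|) ∧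
      (∀ s ∈ E ∪ S, |s| ≤ L') ∧ IsNearlyBipartite (E ∪ S) (ε + η) := by
  obtain ⟨F, K, hF, hK, hFb⟩ := exists_isChromaticFor_isNearlyBipartite r (half_pos hη)
  obtain ⟨M, hTM, hM⟩ := hE.exists_union_image_mul hL hFb (half_pos hη).le (half_pos hη) T
  rw [add_assoc, add_halves] at hM
  refine ⟨_, L + M * K, hF.image_mul M, ?_, ?_, hM⟩
  · rintro _ ⟨s, hs, rfl⟩
    have h0 := Int.one_le_abs (hFb.ne_zero (by linarith) hs)
    rw [abs_mul, Nat.abs_cast]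
    have : (T : ℤ) < M := by exact_mod_cast hTM
    nlinarith
  · rintro _ (hs | ⟨s, hs, rfl⟩)
    · have := hL _ hs
      push_cast
      exact this.trans (le_add_of_nonneg_right (by positivity))
    · push_cast
      rw [abs_mul, Nat.abs_cast]
      exact le_add_of_nonneg_of_le (by positivity)
        (mul_le_mul_of_nonneg_left (hK s hs) (by positivity))

/-! ### Windows and stages -/

/-- A nearly bipartite set is missed by the differences of a set that fills a quarter of a long
interval. -/
theorem IsNearlyBipartite.exists_window {E : Set ℤ} {ε : ℝ} (hE : IsNearlyBipartite E ε)
    (hε : ε ≤ 1 / 4) (t : ℕ) :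
    ∃ (T : ℕ) (A : Set ℤ), t < T ∧ A ⊆ Set.Ico (t : ℤ) T ∧ (∀ a ∈ A, ∀ b ∈ A, a - b ∉ E) ∧
      (T : ℝ) / 4 ≤ A.ncard := by
  obtain ⟨m, g, B, -, -, ⟨C, hC⟩, hE⟩ := hE
  have hC0 : 0 ≤ C := by simpa using hC 0
  -- Below `T`, the set `B` and the first `t` integers take up at most T / 4 + C + t ≤ 3T / 8, so
  -- one of the two classes keeps T / 4.
  obtain ⟨T, hT⟩ := exists_nat_gt (8 * (C + t))
  have htT : t < T := by
    have h0 : (0 : ℝ) ≤ t := Nat.cast_nonneg t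
    have : (t : ℝ) < T := by linarith
    exact_mod_cast this
  let A : Bool → Set ℤ := fun b => {x | x ∈ Set.Ico (t : ℤ) T ∧ x ∉ B ∧ g x = b}
  have hfin : ∀ b, (A b).Finite := fun b => (Set.finite_Ico (t : ℤ) T).subset fun x hx => hx.1
  have hcover : Set.Ico (0 : ℤ) T ⊆ ((B ∩ Set.Ico 0 (T : ℤ)) ∪ Set.Ico 0 (t : ℤ)) ∪
      (A true ∪ A false) := by
    intro x hx
    by_cases hB : x ∈ B
    · exact Or.inl (Or.inl ⟨hB, hx⟩)
    · by_cases ht : x < t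
      · exact Or.inl (Or.inr ⟨hx.1, ht⟩)
      · right
        cases hg : g x
        · exact Or.inr ⟨⟨not_lt.1 ht, hx.2⟩, hB, hg⟩
        · exact Or.inl ⟨⟨not_lt.1 ht, hx.2⟩, hB, hg⟩
  have hcard : T ≤ (B ∩ Set.Ico 0 (T : ℤ)).ncard + t + ((A true).ncard + (A false).ncard) := by
    have h1 := Set.ncard_le_ncard hcover
      ((((Set.finite_Ico _ _).inter_of_right _).union (Set.finite_Ico _ _)).union
        ((hfin _).union (hfin _)))
    have h2 : ∀ n : ℕ, (Set.Ico (0 : ℤ) n).ncard = n := fun n => by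
      simp [Set.ncard_eq_toFinset_card']
    have h3 := Set.ncard_union_le (B ∩ Set.Ico 0 (T : ℤ)) (Set.Ico 0 (t : ℤ))
    have h4 := Set.ncard_union_le (A true) (A false)
    have h5 := Set.ncard_union_le ((B ∩ Set.Ico 0 (T : ℤ)) ∪ Set.Ico 0 (t : ℤ)) (A true ∪ A false)
    rw [h2] at h1 h3
    omega
  have hcard' : (T : ℝ) ≤ (B ∩ Set.Ico 0 (T : ℤ)).ncard + t +
      ((A true).ncard + (A false).ncard) := by exact_mod_cast hcard
  have hB := hC T
  have hεT : ε * T ≤ 1 / 4 * T := by gcongr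
  have hbig : ∃ b, (T : ℝ) / 4 ≤ (A b).ncard := by
    by_contra! h
    have h1 := h true
    have h2 := h false
    linarith
  obtain ⟨b, hb⟩ := hbig
  refine ⟨T, A b, htT, fun x hx => hx.1, fun x hx y hy hxy => ?_, hb⟩
  have := hE _ hxy y hy.2.1 (by simpa using hx.2.1)
  rw [add_sub_cancel, hx.2.2, hy.2.2] at this
  simp at this

/-- Passing from one finite stage of the construction, a set of differences and a bound, to the
next one. -/
def IsStageExtension (j : ℕ) (p p' : Set ℤ × ℕ) : Prop :=
  ∃ (S : Set ℤ) (L : ℕ) (A : Set ℤ), p'.1 = p.1 ∪ S ∧ IsChromaticFor j S ∧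
    (∀ s ∈ S, (p.2 : ℤ) < |s|) ∧ (∀ s ∈ p'.1, |s| ≤ L) ∧ p.2 < p'.2 ∧
    A ⊆ Set.Ico (p.2 + L + 1 : ℤ) p'.2 ∧ (∀ a ∈ A, ∀ b ∈ A, a - b ∉ p'.1) ∧
    (p'.2 : ℝ) / 4 ≤ A.ncard

theorem exists_stages : ∃ p : ℕ → Set ℤ × ℕ, (p 0).1 = ∅ ∧
    ∀ j, IsStageExtension j (p j) (p (j + 1)) := by
  -- The errors form a geometric series, so every stage stays below the 1 / 4 that the windows
  -- require.
  let Q : ℕ → Set ℤ × ℕ → Prop := fun j p =>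
    (∃ L : ℕ, ∀ s ∈ p.1, |s| ≤ L) ∧ IsNearlyBipartite p.1 (1 / 4 - 1 / 4 * (1 / 2) ^ j)
  have h0 : Q 0 (∅, 0) := by
    refine ⟨⟨0, by simp⟩, 1, fun _ => true, ∅, one_pos, by simp, ?_, by simp⟩
    simpa using hasDensityLE_empty
  have hstep : ∀ j p, Q j p → ∃ p', Q (j + 1) p' ∧ IsStageExtension j p p' := by
    rintro j ⟨E, T⟩ ⟨⟨L, hL⟩, hE⟩
    have hη : (0 : ℝ) < 1 / 4 * (1 / 2) ^ (j + 1) := by positivity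
    have hη1 : (1 / 4 : ℝ) * (1 / 2) ^ (j + 1) ≤ 1 := by
      have : (1 / 2 : ℝ) ^ (j + 1) ≤ 1 := pow_le_one₀ (by norm_num) (by norm_num)
      linarith
    obtain ⟨S, L', hS, hST, hL', hES⟩ := hE.exists_union hL hη hη1 j T
    rw [show (1 / 4 - 1 / 4 * (1 / 2) ^ j + 1 / 4 * (1 / 2) ^ (j + 1) : ℝ) =
      1 / 4 - 1 / 4 * (1 / 2) ^ (j + 1) by ring] at hES
    obtain ⟨T', A, hT', hA, hfree, hcard⟩ := hES.exists_window (by linarith) (T + L' + 1)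
    exact ⟨(E ∪ S, T'), ⟨⟨L', hL'⟩, hES⟩, S, L', A, rfl, hS, hST, hL', by dsimp only; omega,
      by exact_mod_cast hA, hfree, hcard⟩
  choose! next hQ hnext using hstep
  let p : ℕ → Set ℤ × ℕ := fun j => Nat.rec (∅, 0) next j
  have hp : ∀ j, Q j (p j) := fun j => by
    induction j with
    | zero => exact h0
    | succ j ih => exact hQ j _ ih
  exact ⟨p, rfl, fun j => hnext j _ (hp j)⟩

theorem isChromaticallyRecurrent_of_forall {S : Set ℤ} (h : ∀ r, IsChromaticFor r S) :
    IsChromaticallyRecurrent S := by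
  intro P hP hpart
  choose cell hcell _ using hpart.2
  have hmem : ∀ x, cell x ∈ hP.toFinset := fun x => hP.mem_toFinset.2 (hcell x).1
  obtain ⟨x, y, hxy, hS⟩ := h hP.toFinset.card
    (fun x => hP.toFinset.equivFin ⟨cell x, hmem x⟩) fun x => Fin.is_lt _
  have heq : cell x = cell y := by
    have := hP.toFinset.equivFin.injective (Fin.ext hxy)
    exact congrArg Subtype.val this
  exact ⟨cell x, (hcell x).1, x - y, Set.sub_mem_sub (hcell x).2 (heq ▸ (hcell y).2), hS⟩

theorem upperDensity_pos_of_frequently {A : Set ℤ} {c : ℝ} (hc : 0 < c)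
    (h : ∃ᶠ n : ℕ in atTop, c * n ≤ (A ∩ Set.Icc (1 : ℤ) n).ncard) : 0 < upperDensity A := by
  refine hc.trans_le (le_limsup_of_frequently_le ?_ ?_)
  · refine (h.and_eventually (eventually_gt_atTop 0)).mono fun n hn => ?_
    rw [le_div_iff₀ (by exact_mod_cast hn.2)]
    exact hn.1
  · refine ⟨1, eventually_map.2 (Eventually.of_forall fun n => ?_)⟩
    refine div_le_one_of_le₀ ?_ (Nat.cast_nonneg n)
    have : (A ∩ Set.Icc (1 : ℤ) n).ncard ≤ (Set.Icc (1 : ℤ) n).ncard :=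
      Set.ncard_le_ncard Set.inter_subset_right (Set.finite_Icc _ _)
    have h2 : (Set.Icc (1 : ℤ) n).ncard = n := by simp [Set.ncard_eq_toFinset_card']
    rw [h2] at this
    exact_mod_cast this

theorem theorem1 :
    ∃ S : Set ℤ, IsChromaticallyRecurrent S ∧ ¬ IsDensityRecurrent S := by
  obtain ⟨p, hp0, hp⟩ := exists_stages
  choose S L A hE hS hST hL hT hA hfree hcard using hp
  have hTmono : StrictMono fun j => (p j).2 := strictMono_nat_of_lt_succ hT
  -- Everything added from stage `j` on is larger than `(p j).2`.
  have hsmall : ∀ j k, ∀ s ∈ (p k).1, |s| < (p j).2 → s ∈ (p j).1 := by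
    intro j k s hs hsj
    have hEmono : Monotone fun j => (p j).1 :=
      monotone_nat_of_le_succ fun j => by rw [hE j]; exact Set.subset_union_left
    induction k with
    | zero => simp [hp0] at hs
    | succ k ih =>
      rw [hE k] at hs
      rcases hs with hs | hs
      · exact ih hs
      · have h1 : ((p k).2 : ℤ) < (p j).2 := (hST k s hs).trans hsj
        have h2 : k + 1 ≤ j := hTmono.lt_iff_lt.1 (by exact_mod_cast h1)
        exact hEmono h2 (show s ∈ (p (k + 1)).1 by rw [hE k]; exact Or.inr hs)
  refine ⟨⋃ j, (p j).1, isChromaticallyRecurrent_of_forall fun r χ hχ => ?_, fun hrec => ?_⟩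
  · obtain ⟨x, y, hxy, hs⟩ := hS r χ hχ
    exact ⟨x, y, hxy, Set.mem_iUnion.2 ⟨r + 1, by rw [hE r]; exact Or.inr hs⟩⟩
  -- A difference between windows `i < j` is below `(p (j + 1)).2`, so it could only lie in stage `j
  -- + 1`, whose elements are at most `L j`; but window `j` begins more than `L j` beyond window
  -- `i`.
  · have hlt : ∀ i j, i < j → ∀ a ∈ A i, ∀ b ∈ A j, ∀ k, ∀ s ∈ (p k).1, |s| ≠ b - a := by
      intro i j hij a ha b hb k s hs hsab
      have h1 := hA i ha
      have h2 := hA j hb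
      have h3 : (p (i + 1)).2 ≤ (p j).2 := hTmono.monotone hij
      have h4 : |s| ≤ L j := hL j s (hsmall (j + 1) k s hs (by
        rw [hsab]
        have := h1.1
        have := h2.2
        omega))
      have h5 : ((p (i + 1)).2 : ℤ) ≤ (p j).2 := by exact_mod_cast h3
      have := h1.2
      have := h2.1
      omega
    have hpos : 0 < upperDensity (⋃ j, A j) := by
      refine upperDensity_pos_of_frequently (c := 1 / 4) (by norm_num) ?_
      rw [frequently_atTop]
      intro n
      refine ⟨(p (n + 1)).2, (Nat.le_succ n).trans (hTmono.id_le (n + 1)), ?_⟩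
      have hsub : A n ⊆ (⋃ j, A j) ∩ Set.Icc (1 : ℤ) ((p (n + 1)).2 : ℕ) := by
        intro x hx
        have h1 := hA n hx
        have := h1.1
        have := h1.2
        exact ⟨Set.mem_iUnion.2 ⟨n, hx⟩, by omega, by omega⟩
      have h2 := Set.ncard_le_ncard hsub ((Set.finite_Icc _ _).inter_of_right _)
      have h3 : ((A n).ncard : ℝ) ≤
          ((⋃ j, A j) ∩ Set.Icc (1 : ℤ) ((p (n + 1)).2 : ℕ)).ncard := by exact_mod_cast h2
      linarith [hcard n]
    obtain ⟨s, ⟨a, ha, b, hb, hab⟩, hs⟩ := hrec _ hpos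
    obtain ⟨i, ha⟩ := Set.mem_iUnion.1 ha
    obtain ⟨j, hb⟩ := Set.mem_iUnion.1 hb
    obtain ⟨k, hs⟩ := Set.mem_iUnion.1 hs
    dsimp only at hab
    have ha' := hA i ha
    have hb' := hA j hb
    rcases lt_trichotomy i j with hij | rfl | hij
    · refine hlt i j hij a ha b hb k s hs ?_
      have h1 := ha'.2
      have h2 := hb'.1
      have h3 : ((p (i + 1)).2 : ℤ) ≤ (p j).2 := by exact_mod_cast hTmono.monotone hij
      rw [← hab, abs_sub_comm, abs_of_nonneg (by omega)]
    · refine hfree i a ha b hb ?_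
      rw [hab]
      refine hsmall (i + 1) k s hs ?_
      rw [← hab, abs_lt]
      have h1 := ha'.1
      have h2 := ha'.2
      have h3 := hb'.1
      have h4 := hb'.2
      constructor <;> omega
    · refine hlt j i hij b hb a ha k s hs ?_
      have h1 := hb'.2
      have h2 := ha'.1
      have h3 : ((p (j + 1)).2 : ℤ) ≤ (p i).2 := by exact_mod_cast hTmono.monotone hij
      rw [← hab, abs_of_nonneg (by omega)]
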